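/- Let $m,n\ge 2$ be integers, let $\mathbb M_n$ be the space of complex $n\times n$ matrices, and for $Z\in\mathbb M_n$ let $$|Z|_{\mathrm{qsym}}:=\sqrt{(\Re Z)^2+(\Im Z)^2},\qquad \Re Z=\frac{Z+Z^*}{2},\quad \Im Z=\frac{Z-Z^*}{2i},$$ where $\sqrt{\cdot}$ is the positive semidefinite square root. A norm $\|\cdot\|$ on $\mathbb M_n$ is called unitarily invariant if $\|UZV\|=\|Z\|$ for all $Z\in\mathbb M_n$ and all unitary $U,V\in\mathbb M_n$. Then for every unitarily invariant norm $\|\cdot\|$ on $\mathbb M_n$ and all $A_1,\dots,A_m\in\mathbb M_n$, $$\Bigl\|\sum_{k=1}^m A_k\Bigr\|\le\sqrt2\,\Bigl\|\sum_{k=1}^m|A_k|_{\mathrm{qsym}}\Bigr\|$$ (the inequality itself does not need $m,n\ge2$). Moreover, for each pair $m,n\ge2$ the constant $\sqrt2$ is sharp: if a real number $c$ satisfies $\|\sum_{k=1}^m A_k\|\le c\,\|\sum_{k=1}^m|A_k|_{\mathrm{qsym}}\|$ for every unitarily invariant norm on $\mathbb M_n$ and all $A_1,\dots,A_m\in\mathbb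 M_n$, then $c\ge\sqrt2$. -/

import Mathlib

/-- The quadratic symmetric modulus `√((Re Z)² + (Im Z)²)` of a square complex matrix `Z`, where
`Re Z = (Z + Z*) / 2`, `Im Z = (Z - Z*) / (2i)`, and the root is the positive semidefinite one. -/
noncomputable def qsymModulus {n : ℕ} (Z : Matrix (Fin n) (Fin n) ℂ) :
    Matrix (Fin n) (Fin n) ℂ :=
  open scoped MatrixOrder ComplexOrder in
  CFC.sqrt ((realPart Z : Matrix (Fin n) (Fin n) ℂ) ^ 2
    + (imaginaryPart Z : Matrix (Fin n) (Fin n) ℂ) ^ 2)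

/-- The seminorm `N` on the `n × n` complex matrices is a norm and is unitarily invariant. -/
structure IsUnitarilyInvariantNorm {n : ℕ} (N : Seminorm ℂ (Matrix (Fin n) (Fin n) ℂ)) :
    Prop where
  eq_zero_of_map_eq_zero : ∀ Z : Matrix (Fin n) (Fin n) ℂ, N Z = 0 → Z = 0
  map_unitary_mul_mul_unitary : ∀ U ∈ Matrix.unitaryGroup (Fin n) ℂ,
    ∀ V ∈ Matrix.unitaryGroup (Fin n) ℂ, ∀ Z : Matrix (Fin n) (Fin n) ℂ, N (U * Z * V) = N Z

/-! Write `T = ∑ A k` in polar form `T = U|T|`, so that `2|T| = ∑ (U* A k + (A k)* U)`. Each summand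
is at most `U*|(A k)*|U + |A k|` (`star_mul_add_star_mul_le_abs`). Both `A*A` and `AA*` are at most
`A*A + AA*`, which is twice the square of the quadratic symmetric modulus, so operator monotonicity
of the square root bounds `|A|` and `|A*|` by `√2` times that modulus. With `S` the sum of the
moduli, `2|T| ≤ √2 (U*SU + S)`; monotonicity of the norm on positive matrices
(`IsUnitarilyInvariantNorm.mono`) and the triangle inequality finish. Sharpness: the operator norm,
with one off-diagonal matrix unit and zeros elsewhere. -/

section PolarDecomposition

/-- Two operators on a finite-dimensional inner product space with the same pointwise norms differ
by a unitary factor on the left. -/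
theorem exists_unitary_eq_mul_of_norm_eq {E : Type*} [NormedAddCommGroup E]
    [InnerProductSpace ℂ E] [FiniteDimensional ℂ E] (A B : E →L[ℂ] E)
    (h : ∀ x, ‖A x‖ = ‖B x‖) : ∃ U ∈ unitary (E →L[ℂ] E), A = U * B := by
  obtain ⟨g, hg⟩ := (B : E →ₗ[ℂ] E).rangeRestrict.exists_rightInverse_of_surjective
    (LinearMap.range_rangeRestrict _)
  have hBg : ∀ y, B (g y) = y := fun y => congrArg Subtype.val (LinearMap.congr_fun hg y)
  -- The map `B x ↦ A x` is isometric on the range of `B`; by finite dimension it extends to a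
  -- unitary of `E`.
  let L : LinearMap.range (B : E →ₗ[ℂ] E) →ₗᵢ[ℂ] E :=
    { toLinearMap := (A : E →ₗ[ℂ] E) ∘ₗ g
      norm_map' := fun y => by
        rw [LinearMap.comp_apply, ContinuousLinearMap.coe_coe, h, hBg]; rfl }
  let e : E ≃ₗᵢ[ℂ] E := L.extend.toLinearIsometryEquiv rfl
  refine ⟨Unitary.linearIsometryEquiv.symm e, (Unitary.linearIsometryEquiv.symm e).2, ?_⟩
  ext x
  let y : LinearMap.range (B : E →ₗ[ℂ] E) := ⟨B x, x, rfl⟩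
  have hx : A (x - g y) = 0 := by
    rw [← norm_eq_zero, h, map_sub, hBg, sub_self, norm_zero]
  rw [map_sub, sub_eq_zero] at hx
  have he : L.extend (y : E) = A (g y) := L.extend_apply y
  exact hx.trans he.symm

open scoped Matrix.Norms.L2Operator in
-- `A*A` determines every `‖A x‖`. Taking `B = |A|` yields the polar decomposition.
theorem Matrix.exists_unitary_eq_mul_of_star_mul_self_eq {n : ℕ} {A B : Matrix (Fin n) (Fin n) ℂ}
    (h : star A * A = star B * B) : ∃ U ∈ unitary (Matrix (Fin n) (Fin n) ℂ), A = U * B := by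
  let φ := Matrix.toEuclideanCLM (n := Fin n) (𝕜 := ℂ)
  have hsq : ∀ (C : Matrix (Fin n) (Fin n) ℂ) x,
      ((‖φ C x‖ ^ 2 : ℝ) : ℂ) = inner ℂ (φ (star C * C) x) x := fun C x => by
    rw [map_mul, map_star, mul_apply_eq_comp, ContinuousLinearMap.star_eq_adjoint,
      ContinuousLinearMap.adjoint_inner_left, inner_self_eq_norm_sq_to_K]
    simp
  obtain ⟨U, hU, hAB⟩ := exists_unitary_eq_mul_of_norm_eq (φ A) (φ B) fun x => by
    have : ‖φ A x‖ ^ 2 = ‖φ B x‖ ^ 2 := by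
      exact_mod_cast (hsq A x).trans ((congrArg (fun C => inner ℂ (φ C x) x) h).trans (hsq B x).symm)
    exact (sq_eq_sq₀ (norm_nonneg _) (norm_nonneg _)).1 this
  refine ⟨φ.symm U, Unitary.map_mem φ.symm hU, EquivLike.injective φ ?_⟩
  rw [hAB, map_mul, StarAlgEquiv.apply_symm_apply]

end PolarDecomposition

section UnitarilyInvariant

open scoped Matrix.Norms.L2Operator MatrixOrder ComplexOrder

variable {n : ℕ} {N : Seminorm ℂ (Matrix (Fin n) (Fin n) ℂ)}

theorem IsUnitarilyInvariantNorm.map_mul_left (hN : IsUnitarilyInvariantNorm N)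
    {U : Matrix (Fin n) (Fin n) ℂ} (hU : U ∈ unitary (Matrix (Fin n) (Fin n) ℂ))
    (Z : Matrix (Fin n) (Fin n) ℂ) : N (U * Z) = N Z := by
  simpa using hN.map_unitary_mul_mul_unitary U hU 1 (one_mem _) Z

theorem IsUnitarilyInvariantNorm.map_star_mul_mul (hN : IsUnitarilyInvariantNorm N)
    {U : Matrix (Fin n) (Fin n) ℂ} (hU : U ∈ unitary (Matrix (Fin n) (Fin n) ℂ))
    (Z : Matrix (Fin n) (Fin n) ℂ) : N (star U * Z * U) = N Z :=
  hN.map_unitary_mul_mul_unitary _ (Unitary.star_mem hU) _ hU Z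

/-- A self-adjoint contraction is the mean of the unitaries `K ± i√(1 - K²)`; the triangle
inequality is applied once on each side. -/
theorem IsUnitarilyInvariantNorm.map_mul_mul_le (hN : IsUnitarilyInvariantNorm N)
    {K : Matrix (Fin n) (Fin n) ℂ} (hK : IsSelfAdjoint K) (hK1 : ‖K‖ ≤ 1)
    (Z : Matrix (Fin n) (Fin n) ℂ) : N (K * Z * K) ≤ N Z := by
  obtain ⟨u, hmem, hu⟩ : ∃ u ∈ unitary (Matrix (Fin n) (Fin n) ℂ),
      K = (1 / 2 : ℂ) • (u + star u) := by
    refine ⟨_, hK.self_add_I_smul_cfcSqrt_sub_sq_mem_unitary K hK1, ?_⟩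
    have hR : star (CFC.sqrt (1 - K ^ 2)) = CFC.sqrt (1 - K ^ 2) :=
      (CFC.sqrt_nonneg (1 - K ^ 2)).isSelfAdjoint
    rw [star_add, star_smul, hK.star_eq, hR,
      RCLike.star_def, Complex.conj_I, neg_smul, ← sub_eq_add_neg, add_add_sub_cancel,
      ← two_smul ℂ, smul_smul]
    simp
  have half : ∀ X Y : Matrix (Fin n) (Fin n) ℂ, ∀ r, N X ≤ r → N Y ≤ r →
      N ((1 / 2 : ℂ) • (X + Y)) ≤ r := fun X Y r hX hY => by
    rw [map_smul_eq_mul]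
    have := map_add_le_add N X Y
    norm_num
    linarith
  have hv : ∀ v ∈ unitary (Matrix (Fin n) (Fin n) ℂ), N (K * Z * v) ≤ N Z := fun v hv => by
    have : K * Z * v = (1 / 2 : ℂ) • (u * Z * v + star u * Z * v) := by
      conv_lhs => rw [hu]
      simp only [smul_mul_assoc, add_mul]
    rw [this]
    exact half _ _ _ (hN.map_unitary_mul_mul_unitary _ hmem _ hv Z).le
      (hN.map_unitary_mul_mul_unitary _ (Unitary.star_mem hmem) _ hv Z).le
  have : K * Z * K = (1 / 2 : ℂ) • (K * Z * u + K * Z * star u) := by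
    conv_lhs => rw [hu]
    conv_rhs => rw [hu]
    simp only [mul_smul_comm, mul_add]
  rw [this]
  exact half _ _ _ (hv _ hmem) (hv _ (Unitary.star_mem hmem))

theorem IsUnitarilyInvariantNorm.map_star_mul_self (hN : IsUnitarilyInvariantNorm N)
    (Z : Matrix (Fin n) (Fin n) ℂ) : N (star Z * Z) = N (Z * star Z) := by
  obtain ⟨U, hU, h⟩ := Matrix.exists_unitary_eq_mul_of_star_mul_self_eq (A := Z) (B := CFC.abs Z)
    (by rw [(CFC.abs_nonneg Z).isSelfAdjoint.star_eq, CFC.abs_mul_abs])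
  have h2 : Z * star Z = U * (star Z * Z) * star U := by
    conv_lhs => rw [h]
    rw [← CFC.abs_mul_abs, star_mul, (CFC.abs_nonneg Z).isSelfAdjoint.star_eq]
    simp only [mul_assoc]
  rw [h2, hN.map_unitary_mul_mul_unitary _ hU _ (Unitary.star_mem hU)]

/-- With `b = √Y` and `K = √(b⁻¹Xb⁻¹)`, a contraction, `X = (Kb)*(Kb)`. Swapping the factors
preserves the norm and gives `(Kb)(Kb)* = KYK`. -/
theorem IsUnitarilyInvariantNorm.mono_of_isUnit (hN : IsUnitarilyInvariantNorm N)
    {X Y : Matrix (Fin n) (Fin n) ℂ} (hX : 0 ≤ X) (hXY : X ≤ Y) (hY : IsUnit Y) : N X ≤ N Y := by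
  have hY0 : 0 ≤ Y := hX.trans hXY
  obtain ⟨b, hb⟩ := (CFC.isUnit_sqrt_iff Y hY0).2 hY
  have hbs : star (b : Matrix (Fin n) (Fin n) ℂ) = b := by
    rw [hb]; exact (CFC.sqrt_nonneg Y).isSelfAdjoint
  have hbb : (b : Matrix (Fin n) (Fin n) ℂ) * b = Y := by rw [hb, CFC.sqrt_mul_sqrt_self Y]
  let c : Matrix (Fin n) (Fin n) ℂ := ↑b⁻¹
  have hbc : (b : Matrix (Fin n) (Fin n) ℂ) * c = 1 := b.mul_inv
  have hcb : c * (b : Matrix (Fin n) (Fin n) ℂ) = 1 := b.inv_mul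
  have hcs : star c = c := by
    have : star b = b := Units.ext hbs
    change star ((b⁻¹ : (Matrix (Fin n) (Fin n) ℂ)ˣ) : Matrix (Fin n) (Fin n) ℂ) = _
    rw [← Units.coe_star, star_inv, this]
  let H := star c * X * c
  have hH0 : 0 ≤ H := star_left_conjugate_nonneg hX c
  have hH1 : H ≤ 1 := by
    refine (star_left_conjugate_le_conjugate hXY c).trans_eq ?_
    rw [hcs, ← hbb, ← mul_assoc, hcb, one_mul, hbc]
  have hXH : X = b * H * b := by
    simp only [H, hcs]
    calc X = (b * c) * X * (c * b) := by rw [hbc, hcb, one_mul, mul_one]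
      _ = _ := by simp only [mul_assoc]
  let K := CFC.sqrt H
  have hKs : IsSelfAdjoint K := (CFC.sqrt_nonneg H).isSelfAdjoint
  have hKK : K * K = H := CFC.sqrt_mul_sqrt_self H
  have hK1 : ‖K‖ ≤ 1 := by
    rw [CStarAlgebra.norm_le_one_iff_of_nonneg K (CFC.sqrt_nonneg H)]
    simpa using CFC.sqrt_le_sqrt H 1 hH1
  calc N X = N (star (K * b) * (K * b)) := by
        rw [star_mul, hbs, hKs.star_eq, hXH, ← hKK]; simp only [mul_assoc]
    _ = N (K * Y * K) := by
        rw [hN.map_star_mul_self, star_mul, hbs, hKs.star_eq, ← hbb]; simp only [mul_assoc]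
    _ ≤ N Y := hN.map_mul_mul_le hKs hK1 Y

/-- A unitarily invariant norm is monotone on the cone of positive semidefinite matrices. -/
theorem IsUnitarilyInvariantNorm.mono (hN : IsUnitarilyInvariantNorm N)
    {X Y : Matrix (Fin n) (Fin n) ℂ} (hX : 0 ≤ X) (hXY : X ≤ Y) : N X ≤ N Y := by
  -- Adding `ε • 1` makes `Y` invertible; then `ε` tends to `0`.
  have key : ∀ ε : ℝ, 0 < ε → N X ≤ N Y + ε * N 1 := fun ε hε => by
    have hp : (0 : Matrix (Fin n) (Fin n) ℂ) ≤ (ε : ℂ) • 1 :=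
      smul_nonneg (by exact_mod_cast hε.le) zero_le_one
    have hu : IsUnit (Y + (ε : ℂ) • (1 : Matrix (Fin n) (Fin n) ℂ)) := by
      apply Matrix.PosDef.isUnit
      refine Matrix.PosDef.posSemidef_add (Matrix.nonneg_iff_posSemidef.1 (hX.trans hXY)) ?_
      exact Matrix.PosDef.one.smul (by exact_mod_cast hε)
    refine (hN.mono_of_isUnit hX (hXY.trans (le_add_of_nonneg_right hp)) hu).trans ?_
    refine (map_add_le_add N _ _).trans ?_
    rw [map_smul_eq_mul, Complex.norm_real, Real.norm_of_nonneg hε.le]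
  refine le_of_forall_pos_le_add fun δ hδ => ?_
  -- The shift by one covers `n = 0`, where `N 1 = 0`.
  have h1 : 0 < N 1 + 1 := add_pos_of_nonneg_of_pos (apply_nonneg _ _) one_pos
  refine (key (δ / (N 1 + 1)) (div_pos hδ h1)).trans ?_
  have : δ / (N 1 + 1) * N 1 ≤ δ := by
    rw [div_mul_eq_mul_div, div_le_iff₀ h1]; nlinarith
  linarith

end UnitarilyInvariant

section QsymModulus

open scoped Matrix.Norms.L2Operator MatrixOrder ComplexOrder

variable {n : ℕ}

/-- For `Z = X + iY` the commutator terms of `Z*Z` and `ZZ*` are opposite and cancel. -/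
theorem realPart_sq_add_imaginaryPart_sq (Z : Matrix (Fin n) (Fin n) ℂ) :
    (realPart Z : Matrix (Fin n) (Fin n) ℂ) ^ 2 + (imaginaryPart Z : Matrix (Fin n) (Fin n) ℂ) ^ 2
      = (1 / 2 : ℝ) • (star Z * Z + Z * star Z) := by
  have hZ := realPart_add_I_smul_imaginaryPart Z
  have hX : star (realPart Z : Matrix (Fin n) (Fin n) ℂ) = realPart Z := (realPart Z).2
  have hY : star (imaginaryPart Z : Matrix (Fin n) (Fin n) ℂ) = imaginaryPart Z :=
    (imaginaryPart Z).2
  generalize (realPart Z : Matrix (Fin n) (Fin n) ℂ) = X at *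
  generalize (imaginaryPart Z : Matrix (Fin n) (Fin n) ℂ) = Y at *
  subst hZ
  simp only [star_add, star_smul, hX, hY, add_mul, mul_add, smul_mul_assoc, mul_smul_comm,
    RCLike.star_def, Complex.conj_I, neg_smul, neg_mul, mul_neg, sq]
  match_scalars <;> ring_nf
  simp

theorem qsymModulus_nonneg (Z : Matrix (Fin n) (Fin n) ℂ) : 0 ≤ qsymModulus Z :=
  CFC.sqrt_nonneg _

theorem qsymModulus_eq_sqrt (Z : Matrix (Fin n) (Fin n) ℂ) :
    qsymModulus Z = CFC.sqrt ((1 / 2 : ℝ) • (star Z * Z + Z * star Z)) := by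
  rw [← realPart_sq_add_imaginaryPart_sq]; rfl

theorem sqrt_two_smul_qsymModulus (Z : Matrix (Fin n) (Fin n) ℂ) :
    Real.sqrt 2 • qsymModulus Z = CFC.sqrt (star Z * Z + Z * star Z) := by
  have h0 : 0 ≤ star Z * Z + Z * star Z :=
    add_nonneg (star_mul_self_nonneg Z) (mul_star_self_nonneg Z)
  symm
  refine CFC.sqrt_unique ?_ (smul_nonneg (Real.sqrt_nonneg 2) (qsymModulus_nonneg Z))
  rw [qsymModulus_eq_sqrt, smul_mul_smul_comm, CFC.sqrt_mul_sqrt_self _ (smul_nonneg (by norm_num) h0),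
    smul_smul, Real.mul_self_sqrt (by norm_num)]
  norm_num

theorem abs_le_sqrt_two_smul_qsymModulus (Z : Matrix (Fin n) (Fin n) ℂ) :
    CFC.abs Z ≤ Real.sqrt 2 • qsymModulus Z := by
  rw [sqrt_two_smul_qsymModulus]
  exact CFC.sqrt_le_sqrt _ _ (le_add_of_nonneg_right (mul_star_self_nonneg Z))

theorem abs_star_le_sqrt_two_smul_qsymModulus (Z : Matrix (Fin n) (Fin n) ℂ) :
    CFC.abs (star Z) ≤ Real.sqrt 2 • qsymModulus Z := by
  rw [sqrt_two_smul_qsymModulus]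
  refine CFC.sqrt_le_sqrt _ _ ?_
  rw [star_star]
  exact le_add_of_nonneg_left (star_mul_self_nonneg Z)

/-- With `A = VP` polar, `|A*| = VPV*`, and the difference of the two sides is `W*PW ≥ 0` for `W =
V*U - 1`. -/
theorem star_mul_add_star_mul_le_abs (U A : Matrix (Fin n) (Fin n) ℂ) :
    star U * A + star A * U ≤ star U * CFC.abs (star A) * U + CFC.abs A := by
  have hP0 := CFC.abs_nonneg A
  have hPs : star (CFC.abs A) = CFC.abs A := hP0.isSelfAdjoint
  obtain ⟨V, hV, h⟩ := Matrix.exists_unitary_eq_mul_of_star_mul_self_eq (A := A) (B := CFC.abs A)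
    (by rw [hPs, CFC.abs_mul_abs])
  have hVV : star V * V = 1 := Unitary.star_mul_self_of_mem hV
  have habs : CFC.abs (star A) = V * CFC.abs A * star V := by
    refine CFC.sqrt_unique ?_ (star_right_conjugate_nonneg hP0 V)
    rw [star_star]
    conv_rhs => rw [h]
    rw [star_mul, hPs]
    calc _ = V * CFC.abs A * (star V * V) * CFC.abs A * star V := by simp only [mul_assoc]
      _ = _ := by rw [hVV]; simp only [mul_assoc, one_mul]
  have key := star_left_conjugate_nonneg hP0 (star V * U - 1)
  rw [habs, ← sub_nonneg]
  generalize CFC.abs A = P at *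
  subst h
  convert key using 1
  simp only [star_mul, star_sub, star_star, star_one, hPs, sub_mul, mul_sub, one_mul, mul_one,
    mul_assoc]
  abel

end QsymModulus

section Main

open scoped Matrix.Norms.L2Operator MatrixOrder ComplexOrder

theorem IsUnitarilyInvariantNorm.map_sum_le {m n : ℕ} {N : Seminorm ℂ (Matrix (Fin n) (Fin n) ℂ)}
    (hN : IsUnitarilyInvariantNorm N) (A : Fin m → Matrix (Fin n) (Fin n) ℂ) :
    N (∑ k, A k) ≤ Real.sqrt 2 * N (∑ k, qsymModulus (A k)) := by
  set T := ∑ k, A k with hT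
  set S := ∑ k, qsymModulus (A k) with hS
  have hP0 := CFC.abs_nonneg T
  have hPs : star (CFC.abs T) = CFC.abs T := hP0.isSelfAdjoint
  obtain ⟨U, hU, h⟩ := Matrix.exists_unitary_eq_mul_of_star_mul_self_eq (A := T) (B := CFC.abs T)
    (by rw [hPs, CFC.abs_mul_abs])
  have hUT : star U * T = CFC.abs T := by
    conv_lhs => rw [h]
    rw [← mul_assoc, Unitary.star_mul_self_of_mem hU, one_mul]
  have hTU : star T * U = CFC.abs T := by
    rw [← hPs, ← hUT, star_mul, star_star]
  have hle : CFC.abs T + CFC.abs T ≤ Real.sqrt 2 • (star U * S * U + S) := by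
    calc CFC.abs T + CFC.abs T = ∑ k, (star U * A k + star (A k) * U) := by
          rw [Finset.sum_add_distrib, ← Finset.mul_sum, ← Finset.sum_mul, ← star_sum, ← hT, hUT,
            hTU]
      _ ≤ ∑ k, Real.sqrt 2 • (star U * qsymModulus (A k) * U + qsymModulus (A k)) := by
          refine Finset.sum_le_sum fun k _ => (star_mul_add_star_mul_le_abs U (A k)).trans ?_
          rw [smul_add]
          refine add_le_add ?_ (abs_le_sqrt_two_smul_qsymModulus _)
          refine (star_left_conjugate_le_conjugate
            (abs_star_le_sqrt_two_smul_qsymModulus (A k)) U).trans_eq ?_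
          rw [mul_smul_comm, smul_mul_assoc]
      _ = _ := by
          rw [← Finset.smul_sum, Finset.sum_add_distrib, ← Finset.sum_mul, ← Finset.mul_sum]
  have hr : ∀ (r : ℝ) X, N (r • X) = |r| * N X := fun r X => by
    rw [← Complex.coe_smul, map_smul_eq_mul, Complex.norm_real, Real.norm_eq_abs]
  have h1 := hN.mono (add_nonneg hP0 hP0) hle
  have h2 : N (CFC.abs T + CFC.abs T) = 2 * N T := by
    rw [← two_smul ℝ, hr, abs_two, ← hUT, hN.map_mul_left (Unitary.star_mem hU)]
  have h3 := map_add_le_add N (star U * S * U) S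
  rw [hN.map_star_mul_mul hU] at h3
  rw [h2, hr, abs_of_nonneg (Real.sqrt_nonneg 2)] at h1
  nlinarith [Real.sqrt_nonneg 2]

theorem norm_eq_one_of_isStarProjection {n : ℕ} {P : Matrix (Fin n) (Fin n) ℂ}
    (hP : IsStarProjection P) (h0 : P ≠ 0) : ‖P‖ = 1 := by
  have h := CStarRing.norm_star_mul_self (x := P)
  rw [hP.isSelfAdjoint.star_eq, hP.isIdempotentElem.eq] at h
  exact (mul_eq_left₀ (norm_ne_zero_iff.2 h0)).1 h.symm

theorem isUnitarilyInvariantNorm_normSeminorm (n : ℕ) :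
    IsUnitarilyInvariantNorm (normSeminorm ℂ (Matrix (Fin n) (Fin n) ℂ)) where
  eq_zero_of_map_eq_zero Z hZ := norm_eq_zero.1 hZ
  map_unitary_mul_mul_unitary U hU V hV Z := by
    change ‖U * Z * V‖ = ‖Z‖
    rw [CStarRing.norm_mul_mem_unitary _ hV, CStarRing.norm_mem_unitary_mul _ hU]

/-- For `Z` an off-diagonal matrix unit, `Z*Z + ZZ*` is a projection of rank two, hence its own
square root. -/
theorem exists_sqrt_two_mul_norm_qsymModulus_eq {n : ℕ} (hn : 2 ≤ n) :
    ∃ Z : Matrix (Fin n) (Fin n) ℂ, ‖Z‖ = 1 ∧ Real.sqrt 2 * ‖qsymModulus Z‖ = 1 := by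
  let i : Fin n := ⟨0, by omega⟩
  let j : Fin n := ⟨1, by omega⟩
  have hij : i ≠ j := by simp [i, j]
  have hstar : ∀ a b : Fin n, star (Matrix.single a b (1 : ℂ)) = Matrix.single b a 1 := fun a b => by
    rw [Matrix.star_eq_conjTranspose, Matrix.conjTranspose_single, star_one]
  let P : Matrix (Fin n) (Fin n) ℂ := Matrix.single j j 1 + Matrix.single i i 1
  have hP : IsStarProjection P := by
    refine ⟨?_, ?_⟩
    · simp [IsIdempotentElem, P, add_mul, mul_add, Matrix.single_mul_single_of_ne, hij, hij.symm]
    · simp only [IsSelfAdjoint, P, star_add, hstar]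
  have hQ : IsStarProjection (Matrix.single j j (1 : ℂ)) :=
    ⟨by simp [IsIdempotentElem], hstar j j⟩
  have hZ : star (Matrix.single i j (1 : ℂ)) * Matrix.single i j 1 = Matrix.single j j 1 := by
    simp [hstar]
  have hZ' : Matrix.single i j 1 * star (Matrix.single i j (1 : ℂ)) = Matrix.single i i 1 := by
    simp [hstar]
  have hQ0 : Matrix.single j j (1 : ℂ) ≠ 0 := fun h => by
    simpa using congrFun (congrFun h j) j
  have hP0 : P ≠ 0 := fun h => by
    simpa [P, Matrix.single_apply, hij] using congrFun (congrFun h j) j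
  refine ⟨Matrix.single i j 1, ?_, ?_⟩
  · have h := CStarRing.norm_star_mul_self (x := Matrix.single i j (1 : ℂ))
    rw [hZ, norm_eq_one_of_isStarProjection hQ hQ0] at h
    nlinarith [norm_nonneg (Matrix.single i j (1 : ℂ))]
  · have h : Real.sqrt 2 • qsymModulus (Matrix.single i j (1 : ℂ)) = P := by
      rw [sqrt_two_smul_qsymModulus, hZ, hZ']
      exact CFC.sqrt_unique hP.isIdempotentElem.eq hP.nonneg
    rw [← norm_eq_one_of_isStarProjection hP hP0, ← h, norm_smul,
      Real.norm_of_nonneg (Real.sqrt_nonneg 2)]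

theorem qsymModulus_zero (n : ℕ) : qsymModulus (0 : Matrix (Fin n) (Fin n) ℂ) = 0 := by
  rw [qsymModulus_eq_sqrt]
  simp

theorem sqrt_two_le_of_forall_map_sum_le {m n : ℕ} (hm : 2 ≤ m) (hn : 2 ≤ n) {c : ℝ}
    (h : ∀ A : Fin m → Matrix (Fin n) (Fin n) ℂ, ‖∑ k, A k‖ ≤ c * ‖∑ k, qsymModulus (A k)‖) :
    Real.sqrt 2 ≤ c := by
  obtain ⟨Z, hZ, hq⟩ := exists_sqrt_two_mul_norm_qsymModulus_eq hn
  let i : Fin m := ⟨0, by omega⟩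
  have h1 := h (Pi.single i Z)
  have hsum : ∑ k, qsymModulus ((Pi.single i Z : Fin m → Matrix (Fin n) (Fin n) ℂ) k)
      = qsymModulus Z := by
    rw [Finset.sum_eq_single i (fun k _ hk => by rw [Pi.single_eq_of_ne hk, qsymModulus_zero])
      (by simp), Pi.single_eq_same]
  rw [hsum, Finset.sum_pi_single', if_pos (Finset.mem_univ i), hZ, ← hq] at h1
  -- The cancelled factor is positive because `√2` times it equals `1`.
  refine le_of_mul_le_mul_right h1 ?_
  have := Real.sqrt_nonneg 2
  by_contra hneg
  nlinarith [norm_nonneg (qsymModulus Z)]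

end Main

theorem mainTheorem6 (m n : ℕ) :
    (∀ N : Seminorm ℂ (Matrix (Fin n) (Fin n) ℂ), IsUnitarilyInvariantNorm N →
      ∀ A : Fin m → Matrix (Fin n) (Fin n) ℂ,
        N (∑ k, A k) ≤ Real.sqrt 2 * N (∑ k, qsymModulus (A k))) ∧
    (2 ≤ m → 2 ≤ n → ∀ c : ℝ,
      (∀ N : Seminorm ℂ (Matrix (Fin n) (Fin n) ℂ), IsUnitarilyInvariantNorm N →
        ∀ A : Fin m → Matrix (Fin n) (Fin n) ℂ,
          N (∑ k, A k) ≤ c * N (∑ k, qsymModulus (A k))) →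
      Real.sqrt 2 ≤ c) := by
  refine ⟨fun N hN A => hN.map_sum_le A, fun hm hn c h => ?_⟩
  open scoped Matrix.Norms.L2Operator in
  exact sqrt_two_le_of_forall_map_sum_le hm hn
    (h (normSeminorm ℂ (Matrix (Fin n) (Fin n) ℂ)) (isUnitarilyInvariantNorm_normSeminorm n))
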